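/- Let $m\ge 1$ and let $x\colon\Sigma^{m}\to\mathbb{R}^{m+1}$ be a compact self-shrinker (based at the origin), that is, a smooth immersion of a compact connected smooth $m$-dimensional manifold $\Sigma$ without boundary, endowed with the induced metric, such that $$x^{\perp}=-\mathbf{H},$$ where $(\cdot)^{\perp}$ is the projection onto the normal space of the immersion, $\mathbf{H}=\mathrm{tr}_{\Sigma}\mathbf{A}$ is the mean curvature vector, and $\mathbf{A}=Ddx$ is the second fundamental form (in local coordinates $\mathbf{A}_{ij}=\partial_i\partial_j x-\Gamma_{ij}^{k}\partial_k x$ and $\mathbf{H}=g^{ij}\mathbf{A}_{ij}$). Then, for every hyperplane $\Pi$ through the origin of $\mathbb{R}^{m+1}$, the image $x(\Sigma)$ is not contained in either of the two closed half-spaces determined by $\Pi$: for every $a\in\mathbb{R}^{m+1}\setminus\{0\}$, neither $\langle a,x(p)\rangle\ge 0$ for all $p\in\Sigma$ nor $\langle a,x(p)\rangle\le 0$ for all $p\in\Sigma$. -/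

import Mathlib

open scoped Manifold ContDiff

noncomputable section

namespace SelfShrinker

/-- Euclidean space `ℝⁿ`. -/
abbrev Euc (n : ℕ) : Type := EuclideanSpace ℝ (Fin n)

/-! ### Local formulas

Here `u` is a map from (an open subset of) `ℝᵐ` to `ℝⁿ`, to be thought of as an immersion written
in local coordinates. -/

section Local

variable {m n : ℕ}

/-- The partial derivative `∂ᵢ h` at `y`. -/
def partialDeriv {W : Type*} [NormedAddCommGroup W] [NormedSpace ℝ W]
    (i : Fin m) (h : Euc m → W) (y : Euc m) : W :=
  fderiv ℝ h y (EuclideanSpace.single i (1 : ℝ))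

/-- The metric `gᵢⱼ = ⟨∂ᵢ u, ∂ⱼ u⟩` induced by `u`. -/
def metricMatrix (u : Euc m → Euc n) (y : Euc m) : Matrix (Fin m) (Fin m) ℝ :=
  Matrix.of fun i j => inner ℝ (partialDeriv i u y) (partialDeriv j u y)

/-- The Christoffel symbols of the Levi-Civita connection of the induced metric,
`Γᵏᵢⱼ = ½ gᵏˡ (∂ᵢ gⱼₗ + ∂ⱼ gᵢₗ - ∂ₗ gᵢⱼ)`. -/
def christoffel (u : Euc m → Euc n) (y : Euc m) (k i j : Fin m) : ℝ :=
  (1 / 2) * ∑ l, (metricMatrix u y)⁻¹ k l *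
    (partialDeriv i (fun z => metricMatrix u z j l) y
      + partialDeriv j (fun z => metricMatrix u z i l) y
      - partialDeriv l (fun z => metricMatrix u z i j) y)

/-- The second fundamental form `A = D du`, i.e. the generalized Hessian of `u`:
`Aᵢⱼ = ∂ᵢ ∂ⱼ u - Γᵏᵢⱼ ∂ₖ u`. -/
def secondFundamentalForm (u : Euc m → Euc n) (y : Euc m) (i j : Fin m) : Euc n :=
  partialDeriv i (partialDeriv j u) y - ∑ k, christoffel u y k i j • partialDeriv k u y

/-- The trace `gⁱʲ Aᵢⱼ` of the second fundamental form with respect to the induced metric. -/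
def traceSecondFundamentalForm (u : Euc m → Euc n) (y : Euc m) : Euc n :=
  ∑ i, ∑ j, (metricMatrix u y)⁻¹ i j • secondFundamentalForm u y i j

end Local

section Global

variable {m n : ℕ} {M : Type*} [TopologicalSpace M] [ChartedSpace (Euc m) M]

/-- The mean curvature vector `H = tr A` of `x : M → ℝⁿ` at `p`, where `M` carries the metric
induced by `x`. It is computed in the preferred chart at `p`. -/
def meanCurvatureVector (x : M → Euc n) (p : M) : Euc n :=
  traceSecondFundamentalForm (x ∘ (extChartAt (𝓡 m) p).symm) (extChartAt (𝓡 m) p p)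

/-- The image of the tangent space of `M` at `p` under the differential of `x`. -/
def tangentImage (x : M → Euc n) (p : M) : Submodule ℝ (Euc n) :=
  LinearMap.range (mfderiv (𝓡 m) (𝓡 n) x p : Euc m →L[ℝ] Euc n).toLinearMap

/-- The component of `v` normal to `x` at `p`. -/
def normalPart (x : M → Euc n) (p : M) (v : Euc n) : Euc n :=
  (tangentImage (m := m) x p)ᗮ.starProjection v

end Global

/-- `x : M → ℝᵐ⁺¹` is a self-shrinker based at the origin: a smooth immersed hypersurface with
`x^⊥ = -H`, where `M` carries the induced metric. Connectedness of `M` is a separate type class. -/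
structure IsSelfShrinker {m : ℕ} {M : Type*} [TopologicalSpace M] [ChartedSpace (Euc m) M]
    (x : M → Euc (m + 1)) : Prop where
  smooth : ContMDiff (𝓡 m) (𝓡 (m + 1)) ∞ x
  immersion : ∀ p : M, Function.Injective (mfderiv (𝓡 m) (𝓡 (m + 1)) x p)
  shrinker : ∀ p : M, normalPart (m := m) x p (x p) = -meanCurvatureVector (m := m) x p

end SelfShrinker

end

open scoped Manifold ContDiff Topology

/-! Suppose `⟨a, x⟩ ≥ 0`. At a minimum of `⟨a, x⟩` the vector `a` is normal and the shrinker
equation only forces `⟨a, x⟩ = 0`, so a strong maximum principle would be needed. Subtracting `ε exp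
(|x|² / 2)` replaces it by an elementary second-order test.

At a minimum of the perturbed function put `κ = ε exp (|x|² / 2)`, `v = a - κ x` and `N = x^⊥`.
Criticality says that `v` is normal. Tracing the Hessian with the induced metric and using `H = -N`
gives `⟨a, x⟩ ≤ κ (|N|² - m)` (`inner_le_of_isLocalMin`), hence `|N|² ≥ m ≥ 1`. In codimension one
`|⟨v, x⟩| = |N| |v| ≥ |v|` (`abs_inner_eq_norm_starProjection_mul_norm`). The left side is of order
`κ`, and so is `a = v + κ x`, which is absurd for small `ε`. -/

namespace SelfShrinker

/-! ### Second-order conditions along a curve -/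

section Calculus

/-- Necessary second order condition at a local minimum of a function of one variable. -/
lemma deriv_deriv_nonneg_of_isLocalMin {f : ℝ → ℝ} {t : ℝ} (h : IsLocalMin f t)
    (hc : ContinuousAt f t) : 0 ≤ deriv (deriv f) t := by
  by_contra! hneg
  -- A negative second derivative would make `t` a local maximum too, so `f` would be locally
  -- constant.
  have hmax := isLocalMax_of_deriv_deriv_neg hneg h.deriv_eq_zero hc
  have hconst : f =ᶠ[𝓝 t] fun _ => f t := by
    filter_upwards [h, hmax] with s h₁ h₂
    exact le_antisymm h₂ h₁
  rw [hconst.deriv.deriv_eq] at hneg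
  simp at hneg

variable {V : Type*} [NormedAddCommGroup V] [InnerProductSpace ℝ V]

lemma hasDerivAt_inner_sub_exp {c : ℝ → V} {c' : V} {t : ℝ} (a : V) (ε : ℝ)
    (hc : HasDerivAt c c' t) :
    HasDerivAt (fun s => inner ℝ a (c s) - ε * Real.exp (inner ℝ (c s) (c s) / 2))
      (inner ℝ a c' - ε * (Real.exp (inner ℝ (c t) (c t) / 2) * inner ℝ (c t) c')) t := by
  have h₁ : HasDerivAt (fun s => inner ℝ a (c s)) (inner ℝ a c') t := by
    simpa using (hasDerivAt_const t a).inner ℝ hc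
  have h₂ := ((hc.inner ℝ hc).div_const 2).exp.const_mul ε
  refine (h₁.sub h₂).congr_deriv ?_
  rw [real_inner_comm (c t) c']
  ring

/-- The second order condition at a minimum of `⟨a, c⟩ - ε exp (|c|² / 2)` along a curve `c`. -/
lemma second_variation_nonneg_of_isLocalMin {c c' : ℝ → V} {c'' : V} {t : ℝ} (a : V) (ε : ℝ)
    (hc : ∀ᶠ s in 𝓝 t, HasDerivAt c (c' s) s) (hc' : HasDerivAt c' c'' t)
    (hmin : IsLocalMin
      (fun s => inner ℝ a (c s) - ε * Real.exp (inner ℝ (c s) (c s) / 2)) t) :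
    0 ≤ inner ℝ (a - (ε * Real.exp (inner ℝ (c t) (c t) / 2)) • c t) c''
      - ε * Real.exp (inner ℝ (c t) (c t) / 2)
        * (inner ℝ (c' t) (c' t) + inner ℝ (c t) (c' t) * inner ℝ (c t) (c' t)) := by
  have hct := hc.self_of_nhds
  have hderiv : deriv (fun s => inner ℝ a (c s) - ε * Real.exp (inner ℝ (c s) (c s) / 2))
      =ᶠ[𝓝 t] fun s => inner ℝ a (c' s)
        - ε * (Real.exp (inner ℝ (c s) (c s) / 2) * inner ℝ (c s) (c' s)) := by
    filter_upwards [hc] with s hs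
    exact (hasDerivAt_inner_sub_exp a ε hs).deriv
  have h₁ : HasDerivAt (fun s => inner ℝ a (c' s)) (inner ℝ a c'') t := by
    simpa using (hasDerivAt_const t a).inner ℝ hc'
  have h₂ := ((((hct.inner ℝ hct).div_const 2).exp).mul (hct.inner ℝ hc')).const_mul ε
  have hnn := deriv_deriv_nonneg_of_isLocalMin hmin
    (hasDerivAt_inner_sub_exp a ε hct).continuousAt
  rw [hderiv.deriv_eq] at hnn
  have h₃ := (h₁.sub h₂).deriv
  simp only [Pi.sub_def, Pi.mul_def] at h₃
  rw [h₃] at hnn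
  refine hnn.trans (le_of_eq ?_)
  rw [inner_sub_left, real_inner_smul_left, real_inner_comm (c' t) (c t)]
  ring

end Calculus

/-! ### Traces against positive semidefinite matrices -/

section LinearAlgebra

open scoped MatrixOrder in
/-- The pairing of a positive semidefinite matrix with a nonnegative quadratic form. -/
lemma sum_mul_nonneg_of_posSemidef {ι : Type*} [Fintype ι] [DecidableEq ι] {P : Matrix ι ι ℝ}
    (hP : P.PosSemidef) (B : ι → ι → ℝ)
    (hB : ∀ w : ι → ℝ, 0 ≤ ∑ i, ∑ j, w i * w j * B i j) : 0 ≤ ∑ i, ∑ j, P i j * B i j := by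
  -- With `P = CᵀC`, the pairing is the sum of the values of the quadratic form on the rows of `C`.
  obtain ⟨C, rfl⟩ := CStarAlgebra.nonneg_iff_eq_star_mul_self.mp hP.nonneg
  have : ∑ i, ∑ j, (star C * C) i j * B i j
      = ∑ k, ∑ i, ∑ j, C k i * C k j * B i j := by
    rw [Finset.sum_comm]
    refine (Finset.sum_comm).trans ?_
    simp only [Matrix.mul_apply, Matrix.star_apply, star_trivial, Finset.sum_mul]
    rw [Finset.sum_comm]
    conv_rhs => rw [Finset.sum_comm]
    rw [Finset.sum_comm]
    refine Finset.sum_congr rfl fun i _ => ?_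
    rw [Finset.sum_comm]
  rw [this]
  exact Finset.sum_nonneg fun k _ => hB (C k)

lemma sum_inv_mul_self_of_isSymm {ι : Type*} [Fintype ι] [DecidableEq ι] {g : Matrix ι ι ℝ}
    (hg : g.IsSymm) (hdet : IsUnit g.det) :
    ∑ i, ∑ j, g⁻¹ i j * g i j = Fintype.card ι := by
  rw [← Matrix.trace_one (n := ι) (R := ℝ), ← Matrix.nonsing_inv_mul g hdet, Matrix.trace]
  simp only [Matrix.diag_apply, Matrix.mul_apply]
  exact Finset.sum_congr rfl fun i _ => Finset.sum_congr rfl fun j _ => by rw [hg.apply]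

end LinearAlgebra

/-! ### Immersions in local coordinates -/

section Local

variable {m n : ℕ}

lemma sum_smul_partialDeriv {W : Type*} [NormedAddCommGroup W] [NormedSpace ℝ W]
    (h : Euc m → W) (y w : Euc m) : ∑ i, w i • partialDeriv i h y = fderiv ℝ h y w := by
  conv_rhs => rw [← (EuclideanSpace.basisFun (Fin m) ℝ).sum_repr w]
  simp [partialDeriv]

lemma partialDeriv_partialDeriv {W : Type*} [NormedAddCommGroup W] [NormedSpace ℝ W]
    {h : Euc m → W} {y : Euc m} (hh : DifferentiableAt ℝ (fderiv ℝ h) y) (i j : Fin m) :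
    partialDeriv i (partialDeriv j h) y
      = fderiv ℝ (fderiv ℝ h) y (EuclideanSpace.single i 1) (EuclideanSpace.single j 1) := by
  change fderiv ℝ (fun z => fderiv ℝ h z (EuclideanSpace.single j (1 : ℝ))) y _ = _
  rw [fderiv_clm_apply hh (differentiableAt_const _)]
  simp

lemma sum_mul_sum_smul_partialDeriv_partialDeriv {W : Type*} [NormedAddCommGroup W]
    [NormedSpace ℝ W] {h : Euc m → W} {y : Euc m} (hh : DifferentiableAt ℝ (fderiv ℝ h) y)
    (w : Euc m) :
    ∑ i, ∑ j, (w i * w j) • partialDeriv i (partialDeriv j h) y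
      = fderiv ℝ (fderiv ℝ h) y w w := by
  conv_rhs => rw [← (EuclideanSpace.basisFun (Fin m) ℝ).sum_repr w]
  rw [Finset.sum_comm]
  simp [partialDeriv_partialDeriv hh, Finset.smul_sum, mul_smul]
  exact Finset.sum_congr rfl fun i _ => Finset.sum_congr rfl fun j _ => smul_comm _ _ _

lemma metricMatrix_posDef {u : Euc m → Euc n} {y : Euc m}
    (hinj : Function.Injective (fderiv ℝ u y)) : (metricMatrix u y).PosDef := by
  refine (Matrix.posDef_gram_iff_linearIndependent (𝕜 := ℝ)
    (v := fun i => partialDeriv i u y)).mpr ?_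
  have h := (EuclideanSpace.basisFun (Fin m) ℝ).toBasis.linearIndependent.map'
    (fderiv ℝ u y).toLinearMap (LinearMap.ker_eq_bot.mpr hinj)
  have hcoe : (fderiv ℝ u y).toLinearMap ∘ (EuclideanSpace.basisFun (Fin m) ℝ).toBasis
      = fun i => partialDeriv i u y := by
    funext i
    simp [partialDeriv]
  rwa [hcoe] at h

/-- For tangential `τ = du(w)`, the squared norm of `τ` is `gⁱʲ ⟨τ, ∂ᵢu⟩ ⟨τ, ∂ⱼu⟩`. -/
lemma sum_inv_metricMatrix_mul_inner {u : Euc m → Euc n} {y : Euc m}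
    (hinj : Function.Injective (fderiv ℝ u y)) (w : Euc m) :
    ∑ i, ∑ j, (metricMatrix u y)⁻¹ i j
        * (inner ℝ (fderiv ℝ u y w) (partialDeriv i u y)
          * inner ℝ (fderiv ℝ u y w) (partialDeriv j u y))
      = inner ℝ (fderiv ℝ u y w) (fderiv ℝ u y w) := by
  have hdet : IsUnit (metricMatrix u y).det := (metricMatrix_posDef hinj).det_pos.ne'.isUnit
  have hb : (fun j => inner ℝ (fderiv ℝ u y w) (partialDeriv j u y))
      = (metricMatrix u y).mulVec w := by
    funext j
    rw [← sum_smul_partialDeriv u y w, sum_inner]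
    simp only [Matrix.mulVec, dotProduct, metricMatrix, Matrix.of_apply, real_inner_smul_left]
    exact Finset.sum_congr rfl fun i _ => by rw [real_inner_comm, mul_comm]
  have hinv : (metricMatrix u y)⁻¹.mulVec
      (fun j => inner ℝ (fderiv ℝ u y w) (partialDeriv j u y)) = w := by
    rw [hb, Matrix.mulVec_mulVec, Matrix.nonsing_inv_mul _ hdet, Matrix.one_mulVec]
  have hrow : ∀ i, ∑ j, (metricMatrix u y)⁻¹ i j
      * inner ℝ (fderiv ℝ u y w) (partialDeriv j u y) = w i := fun i => congrFun hinv i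
  calc _ = ∑ i, inner ℝ (fderiv ℝ u y w) (partialDeriv i u y) * w i := by
        refine Finset.sum_congr rfl fun i _ => ?_
        rw [← hrow i, Finset.mul_sum]
        exact Finset.sum_congr rfl fun j _ => by ring
    _ = inner ℝ (fderiv ℝ u y w) (∑ i, w i • partialDeriv i u y) := by
        rw [inner_sum]
        exact Finset.sum_congr rfl fun i _ => by rw [real_inner_smul_right, mul_comm]
    _ = _ := by rw [sum_smul_partialDeriv]

/-- The Christoffel terms of the trace of the second fundamental form are tangential. -/
lemma inner_traceSecondFundamentalForm {u : Euc m → Euc n} {y : Euc m} {v : Euc n}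
    (hv : ∀ k, inner ℝ v (partialDeriv k u y) = 0) :
    inner ℝ v (traceSecondFundamentalForm u y)
      = ∑ i, ∑ j, (metricMatrix u y)⁻¹ i j
        * inner ℝ v (partialDeriv i (partialDeriv j u) y) := by
  simp only [traceSecondFundamentalForm, secondFundamentalForm, inner_sum, real_inner_smul_right,
    inner_sub_right, hv, mul_zero, Finset.sum_const_zero, sub_zero]

/-! ### First- and second-order conditions at a minimum of the perturbed height -/

section Minimum

variable {u : Euc m → Euc n} {y : Euc m} {a : Euc n} {ε : ℝ}

lemma inner_fderiv_eq_zero_of_isLocalMin (hu : DifferentiableAt ℝ u y)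
    (hmin : IsLocalMin
      (fun z => inner ℝ a (u z) - ε * Real.exp (inner ℝ (u z) (u z) / 2)) y) (w : Euc m) :
    inner ℝ (a - (ε * Real.exp (inner ℝ (u y) (u y) / 2)) • u y) (fderiv ℝ u y w) = 0 := by
  have hline : HasDerivAt (fun t : ℝ => y + t • w) w 0 := by
    simpa using ((hasDerivAt_id (0 : ℝ)).smul_const w).const_add y
  have hc : HasDerivAt (fun t : ℝ => u (y + t • w)) (fderiv ℝ u y w) 0 := by
    refine HasFDerivAt.comp_hasDerivAt (0 : ℝ) ?_ hline
    simpa using hu.hasFDerivAt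
  have hmin' : IsLocalMin (fun t : ℝ => inner ℝ a (u (y + t • w))
      - ε * Real.exp (inner ℝ (u (y + t • w)) (u (y + t • w)) / 2)) 0 := by
    refine IsMinFilter.comp_tendsto (l := 𝓝 y) (g := fun t : ℝ => y + t • w)
      (f := fun z => inner ℝ a (u z) - ε * Real.exp (inner ℝ (u z) (u z) / 2)) ?_ ?_
    · simpa [IsLocalMin] using hmin
    · simpa using hline.continuousAt.tendsto
  have h := hmin'.hasDerivAt_eq_zero (hasDerivAt_inner_sub_exp a ε hc)
  simp only [zero_smul, add_zero] at h
  rw [inner_sub_left, real_inner_smul_left, mul_assoc]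
  exact h

/-- Restrict to the line `y + t w`. The plain coordinate Hessian of `u` suffices, since the
Christoffel terms are tangential and `v` is normal. -/
lemma hessian_nonneg_of_isLocalMin (hu : ContDiffAt ℝ 2 u y)
    (hmin : IsLocalMin
      (fun z => inner ℝ a (u z) - ε * Real.exp (inner ℝ (u z) (u z) / 2)) y) (w : Euc m) :
    0 ≤ inner ℝ (a - (ε * Real.exp (inner ℝ (u y) (u y) / 2)) • u y)
        (fderiv ℝ (fderiv ℝ u) y w w)
      - ε * Real.exp (inner ℝ (u y) (u y) / 2)
        * (inner ℝ (fderiv ℝ u y w) (fderiv ℝ u y w)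
          + inner ℝ (u y) (fderiv ℝ u y w) * inner ℝ (u y) (fderiv ℝ u y w)) := by
  have hline : ∀ t : ℝ, HasDerivAt (fun t : ℝ => y + t • w) w t := fun t => by
    simpa using ((hasDerivAt_id t).smul_const w).const_add y
  have htend : Filter.Tendsto (fun t : ℝ => y + t • w) (𝓝 0) (𝓝 y) := by
    simpa using (hline 0).continuousAt.tendsto
  have hdiff : ∀ᶠ z in 𝓝 y, DifferentiableAt ℝ u z :=
    (hu.eventually (by simp)).mono fun z hz => hz.differentiableAt (by norm_num)
  have hd2 : DifferentiableAt ℝ (fderiv ℝ u) y :=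
    (hu.fderiv_right (m := 1) (by norm_num)).differentiableAt (by norm_num)
  have hc : ∀ᶠ t in 𝓝 (0 : ℝ),
      HasDerivAt (fun t : ℝ => u (y + t • w)) (fderiv ℝ u (y + t • w) w) t := by
    filter_upwards [htend.eventually hdiff] with t ht
    exact HasFDerivAt.comp_hasDerivAt t ht.hasFDerivAt (hline t)
  have hc' : HasDerivAt (fun t : ℝ => fderiv ℝ u (y + t • w) w)
      (fderiv ℝ (fderiv ℝ u) y w w) 0 := by
    have h₁ : HasDerivAt (fun t : ℝ => fderiv ℝ u (y + t • w)) (fderiv ℝ (fderiv ℝ u) y w) 0 := by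
      refine HasFDerivAt.comp_hasDerivAt (0 : ℝ) ?_ (hline 0)
      simpa using hd2.hasFDerivAt
    simpa using h₁.clm_apply (hasDerivAt_const (0 : ℝ) w)
  have hmin' : IsLocalMin (fun t : ℝ => inner ℝ a (u (y + t • w))
      - ε * Real.exp (inner ℝ (u (y + t • w)) (u (y + t • w)) / 2)) 0 := by
    refine IsMinFilter.comp_tendsto (l := 𝓝 y) (g := fun t : ℝ => y + t • w)
      (f := fun z => inner ℝ a (u z) - ε * Real.exp (inner ℝ (u z) (u z) / 2)) ?_ htend
    simpa [IsLocalMin] using hmin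
  simpa using second_variation_nonneg_of_isLocalMin a ε hc hc' hmin'

/-- The traced second order condition at a minimum of `⟨a, u⟩ - ε exp (|u|² / 2)`, where `u` is an
immersion satisfying the self-shrinker equation at the point. -/
lemma inner_le_of_isLocalMin (hu : ContDiffAt ℝ 2 u y)
    (hinj : Function.Injective (fderiv ℝ u y))
    (hH : (LinearMap.range (fderiv ℝ u y).toLinearMap)ᗮ.starProjection (u y)
      = -traceSecondFundamentalForm u y)
    (hmin : IsLocalMin
      (fun z => inner ℝ a (u z) - ε * Real.exp (inner ℝ (u z) (u z) / 2)) y) :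
    inner ℝ a (u y) ≤ ε * Real.exp (inner ℝ (u y) (u y) / 2)
      * (‖(LinearMap.range (fderiv ℝ u y).toLinearMap)ᗮ.starProjection (u y)‖ ^ 2 - m) := by
  set T := LinearMap.range (fderiv ℝ u y).toLinearMap with hT
  set κ := ε * Real.exp (inner ℝ (u y) (u y) / 2) with hκ
  set v := a - κ • u y with hv
  set N := Tᗮ.starProjection (u y) with hN
  have hvT : ∀ w, inner ℝ v (fderiv ℝ u y w) = 0 :=
    inner_fderiv_eq_zero_of_isLocalMin (hu.differentiableAt (by norm_num)) hmin
  have hd2 : DifferentiableAt ℝ (fderiv ℝ u) y :=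
    (hu.fderiv_right (m := 1) (by norm_num)).differentiableAt (by norm_num)
  obtain ⟨w, hw⟩ : ∃ w, fderiv ℝ u y w = T.starProjection (u y) :=
    T.starProjection_apply_mem (u y)
  have hsplit : u y = fderiv ℝ u y w + N := by
    rw [hw, hN, Submodule.starProjection_add_starProjection_orthogonal]
  have hNT : ∀ w, inner ℝ N (fderiv ℝ u y w) = 0 := fun w' =>
    Submodule.inner_left_of_mem_orthogonal (K := T) ⟨w', rfl⟩
      (Tᗮ.starProjection_apply_mem (u y))
  have hpos := metricMatrix_posDef hinj
  -- Trace the Hessian inequality against `g⁻¹`: the metric term contributes `m`, the rank-one term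
  -- `|x^T|²`.
  have htr := sum_mul_nonneg_of_posSemidef hpos.inv.posSemidef
    (fun i j => inner ℝ v (partialDeriv i (partialDeriv j u) y)
      - κ * (metricMatrix u y i j
        + inner ℝ (u y) (partialDeriv i u y) * inner ℝ (u y) (partialDeriv j u y))) ?_
  · have h₁ := inner_traceSecondFundamentalForm (u := u) (y := y) (v := v) fun k => hvT _
    have h₂ := sum_inv_mul_self_of_isSymm (g := metricMatrix u y)
      (by simpa using hpos.isHermitian) hpos.det_pos.ne'.isUnit
    have h₃ := sum_inv_metricMatrix_mul_inner hinj w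
    have h₄ : ∀ i, inner ℝ (u y) (partialDeriv i u y)
        = inner ℝ (fderiv ℝ u y w) (partialDeriv i u y) := fun i => by
      conv_lhs => rw [hsplit]
      rw [inner_add_left, partialDeriv, hNT, add_zero]
    simp only [h₄] at htr
    have h₅ : inner ℝ v (traceSecondFundamentalForm u y)
        - κ * (m + inner ℝ (fderiv ℝ u y w) (fderiv ℝ u y w))
        = ∑ i, ∑ j, (metricMatrix u y)⁻¹ i j
          * (inner ℝ v (partialDeriv i (partialDeriv j u) y)
            - κ * (metricMatrix u y i j + inner ℝ (fderiv ℝ u y w) (partialDeriv i u y)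
              * inner ℝ (fderiv ℝ u y w) (partialDeriv j u y))) := by
      rw [Fintype.card_fin] at h₂
      rw [h₁, ← h₃, ← h₂]
      simp only [Finset.mul_sum, ← Finset.sum_add_distrib, ← Finset.sum_sub_distrib]
      exact Finset.sum_congr rfl fun i _ => Finset.sum_congr rfl fun j _ => by ring
    rw [← h₅] at htr
    have h₆ : traceSecondFundamentalForm u y = -N := by rw [hH, neg_neg]
    have h₇ : inner ℝ v (u y) = inner ℝ v N := by
      conv_lhs => rw [hsplit]
      rw [inner_add_right, hvT, zero_add]
    have h₈ : inner ℝ (u y) (u y) = inner ℝ (fderiv ℝ u y w) (fderiv ℝ u y w) + ‖N‖ ^ 2 := by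
      conv_lhs => rw [hsplit]
      rw [inner_add_left, inner_add_right, inner_add_right, hNT,
        real_inner_comm N, hNT, real_inner_self_eq_norm_sq N]
      ring
    -- Here `⟨v, H⟩ = -⟨v, x⟩ = -⟨a, x⟩ + κ |x|²`, and `|x|² - |x^T|² = |N|²` leaves the claimed
    -- bound.
    rw [h₆, inner_neg_right, ← h₇, hv, inner_sub_left, real_inner_smul_left, h₈] at htr
    linarith
  · intro c
    have hnn := hessian_nonneg_of_isLocalMin hu hmin (WithLp.toLp 2 c)
    refine hnn.trans (le_of_eq ?_)
    rw [← sum_mul_sum_smul_partialDeriv_partialDeriv hd2, ← sum_smul_partialDeriv u y]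
    have h₁ : inner ℝ (∑ i, c i • partialDeriv i u y) (∑ i, c i • partialDeriv i u y)
        = ∑ i, ∑ j, c i * c j * metricMatrix u y i j := by
      rw [sum_inner]
      refine Finset.sum_congr rfl fun i _ => ?_
      rw [inner_sum]
      refine Finset.sum_congr rfl fun j _ => ?_
      rw [real_inner_smul_left, real_inner_smul_right, metricMatrix, Matrix.of_apply, mul_assoc]
    have h₂ : inner ℝ (u y) (∑ i, c i • partialDeriv i u y)
          * inner ℝ (u y) (∑ i, c i • partialDeriv i u y)
        = ∑ i, ∑ j, c i * c j
          * (inner ℝ (u y) (partialDeriv i u y) * inner ℝ (u y) (partialDeriv j u y)) := by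
      simp only [inner_sum, real_inner_smul_right, Finset.sum_mul_sum]
      exact Finset.sum_congr rfl fun i _ => Finset.sum_congr rfl fun j _ => by ring
    simp only [h₁, h₂]
    simp only [inner_sum, real_inner_smul_right, Finset.mul_sum,
      ← Finset.sum_add_distrib, ← Finset.sum_sub_distrib]
    exact Finset.sum_congr rfl fun i _ => Finset.sum_congr rfl fun j _ => by ring

end Minimum

end Local

/-! ### Codimension one, passage to charts, and the contradiction -/

section Global

variable {m : ℕ}

/-- The component of `z` along the normal line of an immersed hypersurface. -/
lemma abs_inner_eq_norm_starProjection_mul_norm {L : Euc m →L[ℝ] Euc (m + 1)}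
    (hL : Function.Injective L) {v : Euc (m + 1)} (hv : ∀ w, inner ℝ v (L w) = 0)
    (z : Euc (m + 1)) :
    |inner ℝ v z| = ‖(LinearMap.range L.toLinearMap)ᗮ.starProjection z‖ * ‖v‖ := by
  set T := LinearMap.range L.toLinearMap with hT
  rcases eq_or_ne v 0 with rfl | hv0
  · simp
  have hvT : v ∈ Tᗮ := by
    rw [Submodule.mem_orthogonal']
    rintro _ ⟨w, rfl⟩
    exact hv w
  -- Codimension one enters here: the normal space is a line, spanned by `v`.
  have hrank : Module.finrank ℝ Tᗮ = 1 := by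
    have h₁ : Module.finrank ℝ T = m := by
      rw [hT, LinearMap.finrank_range_of_inj hL, finrank_euclideanSpace_fin]
    have h₂ := T.finrank_add_finrank_orthogonal
    rw [h₁, finrank_euclideanSpace_fin] at h₂
    omega
  obtain ⟨c, hc⟩ := (finrank_eq_one_iff_of_nonzero' (⟨v, hvT⟩ : Tᗮ)
    (by simpa using hv0)).mp hrank ⟨_, Tᗮ.starProjection_apply_mem z⟩
  have hc' : c • v = Tᗮ.starProjection z := congrArg Subtype.val hc
  have hinner : inner ℝ v z = inner ℝ v (Tᗮ.starProjection z) := by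
    rw [← Submodule.inner_starProjection_left_eq_right,
      Submodule.starProjection_eq_self_iff.mpr hvT]
  rw [hinner, ← hc', real_inner_smul_right, real_inner_self_eq_norm_sq, norm_smul, abs_mul,
    abs_of_nonneg (sq_nonneg ‖v‖), Real.norm_eq_abs]
  ring

variable {M : Type*} [TopologicalSpace M] [ChartedSpace (Euc m) M]

lemma contDiffAt_comp_extChartAt_symm {n : ℕ} {x : M → Euc n}
    (hx : ContMDiff (𝓡 m) (𝓡 n) ∞ x) (p : M) :
    ContDiffAt ℝ ∞ (x ∘ (extChartAt (𝓡 m) p).symm) (extChartAt (𝓡 m) p p) := by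
  have h : ContDiffWithinAt ℝ ∞ (x ∘ (extChartAt (𝓡 m) p).symm) (Set.range (𝓡 m))
      (extChartAt (𝓡 m) p p) := (contMDiffAt_iff.mp (hx p)).2
  rwa [ModelWithCorners.range_eq_univ, contDiffWithinAt_univ] at h

lemma mfderiv_eq_fderiv_comp_extChartAt_symm {n : ℕ} {x : M → Euc n}
    (hx : ContMDiff (𝓡 m) (𝓡 n) ∞ x) (p : M) :
    (mfderiv (𝓡 m) (𝓡 n) x p : Euc m →L[ℝ] Euc n)
      = fderiv ℝ (x ∘ (extChartAt (𝓡 m) p).symm) (extChartAt (𝓡 m) p p) := by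
  have h : MDifferentiableAt (𝓡 m) (𝓡 n) x p := (hx p).mdifferentiableAt (by simp)
  refine h.mfderiv.trans ?_
  -- The chart on the Euclidean target is the identity, and the model has no boundary.
  change fderivWithin ℝ (x ∘ (extChartAt (𝓡 m) p).symm) (Set.range (𝓡 m))
    (extChartAt (𝓡 m) p p) = _
  rw [ModelWithCorners.range_eq_univ, fderivWithin_univ]

/-- A compact self-shrinker does not lie in a closed half-space bounded by a hyperplane through the
origin: otherwise `⟨a, x⟩ - ε exp (|x|² / 2)` would have no minimum for small `ε > 0`. -/
theorem IsSelfShrinker.not_forall_inner_nonneg [CompactSpace M] [Nonempty M] (hm : 1 ≤ m)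
    {x : M → Euc (m + 1)} (hx : IsSelfShrinker x) {a : Euc (m + 1)} (ha : a ≠ 0) :
    ¬ ∀ p, 0 ≤ inner ℝ a (x p) := by
  intro hpos
  have hcont : Continuous x := hx.smooth.continuous
  obtain ⟨R, hR⟩ := (isCompact_range hcont).isBounded.exists_norm_le
  replace hR : ∀ p, ‖x p‖ ≤ R := fun p => hR _ ⟨p, rfl⟩
  have hR0 : 0 ≤ R := (norm_nonneg _).trans (hR (Classical.arbitrary M))
  have hna : 0 < ‖a‖ := norm_pos_iff.mpr ha
  have hE : 0 < Real.exp (R ^ 2 / 2) := Real.exp_pos _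
  -- Chosen so that `κ (R + 2 R²) < ‖a‖` at every point; the `+ 1` makes this strict and covers `R =
  -- 0`.
  set ε := ‖a‖ / (Real.exp (R ^ 2 / 2) * (R + 2 * R ^ 2 + 1)) with hε
  have hε0 : 0 < ε := by positivity
  obtain ⟨p, -, hp⟩ := isCompact_univ.exists_isMinOn (s := (Set.univ : Set M)) Set.univ_nonempty
    (f := fun q => inner ℝ a (x q) - ε * Real.exp (inner ℝ (x q) (x q) / 2))
    (by fun_prop)
  set u := x ∘ (extChartAt (𝓡 m) p).symm with hu
  set y := extChartAt (𝓡 m) p p with hy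
  have huy : u y = x p := by simp [hu, hy]
  have hmin : IsLocalMin
      (fun z => inner ℝ a (u z) - ε * Real.exp (inner ℝ (u z) (u z) / 2)) y := by
    -- Every value of `u`, even off the chart target, is a value of `x`, so global minimality on `M`
    -- applies.
    refine Filter.Eventually.of_forall fun z => ?_
    simp only [huy]
    exact hp (Set.mem_univ _)
  have hC2 : ContDiffAt ℝ 2 u y :=
    (contDiffAt_comp_extChartAt_symm hx.smooth p).of_le
      (by norm_cast)
  have hD := mfderiv_eq_fderiv_comp_extChartAt_symm hx.smooth p
  have hinj : Function.Injective (fderiv ℝ u y) := by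
    have h := hx.immersion p
    rwa [hD] at h
  have hH : (LinearMap.range (fderiv ℝ u y).toLinearMap)ᗮ.starProjection (u y)
      = -traceSecondFundamentalForm u y := by
    have h := hx.shrinker p
    have hT : tangentImage (m := m) x p = LinearMap.range (fderiv ℝ u y).toLinearMap :=
      congrArg (fun L : Euc m →L[ℝ] Euc (m + 1) => LinearMap.range L.toLinearMap) hD
    rw [normalPart] at h
    simp only [hT] at h
    rw [huy]
    exact h
  have hle := inner_le_of_isLocalMin hC2 hinj hH hmin
  have hort := abs_inner_eq_norm_starProjection_mul_norm hinj
    (inner_fderiv_eq_zero_of_isLocalMin (hC2.differentiableAt (by norm_num)) hmin) (u y)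
  set N := (LinearMap.range (fderiv ℝ u y).toLinearMap)ᗮ.starProjection (u y) with hN
  have hNx : ‖N‖ ≤ ‖x p‖ := by
    rw [← huy]
    exact Submodule.norm_starProjection_apply_le _ _
  rw [huy] at hle hort
  set κ := ε * Real.exp (inner ℝ (x p) (x p) / 2) with hκ
  have hκ0 : 0 < κ := by positivity
  have hxR := hR p
  have hκR : κ * (R + 2 * R ^ 2) < ‖a‖ := by
    have h₁ : κ ≤ ε * Real.exp (R ^ 2 / 2) := by
      rw [hκ, real_inner_self_eq_norm_sq]
      gcongr
    calc κ * (R + 2 * R ^ 2) ≤ ε * Real.exp (R ^ 2 / 2) * (R + 2 * R ^ 2) := by gcongr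
      _ < ε * Real.exp (R ^ 2 / 2) * (R + 2 * R ^ 2 + 1) :=
        mul_lt_mul_of_pos_left (by linarith) (by positivity)
      _ = ‖a‖ := by rw [hε]; field_simp
  have hfp := hpos p
  have hm1 : (1 : ℝ) ≤ m := by exact_mod_cast hm
  -- Nonnegativity of `⟨a, x⟩` and `κ > 0` force `‖N‖² ≥ m ≥ 1`.
  have hN1 : 1 ≤ ‖N‖ := by
    have h₁ : 0 ≤ ‖N‖ ^ 2 - m := nonneg_of_mul_nonneg_right (hfp.trans hle) hκ0
    nlinarith [norm_nonneg N]
  have hxx : ‖x p‖ ^ 2 ≤ R ^ 2 := by gcongr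
  have hNR : ‖N‖ ^ 2 ≤ R ^ 2 := by gcongr; exact hNx.trans hxR
  have hfR : inner ℝ a (x p) ≤ κ * R ^ 2 :=
    hle.trans (mul_le_mul_of_nonneg_left (by linarith) hκ0.le)
  -- Since `‖N‖ ≥ 1`, `‖v‖ ≤ |⟨v, x⟩| = |⟨a, x⟩ - κ ‖x‖²|`, and both terms lie in `[0, κ R²]`.
  have hv : ‖a - κ • x p‖ ≤ 2 * (κ * R ^ 2) := by
    have h₁ : ‖a - κ • x p‖ ≤ |inner ℝ (a - κ • x p) (x p)| := by
      rw [hort]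
      exact le_mul_of_one_le_left (norm_nonneg _) hN1
    rw [inner_sub_left, real_inner_smul_left, real_inner_self_eq_norm_sq] at h₁
    have h₂ : κ * ‖x p‖ ^ 2 ≤ κ * R ^ 2 := by gcongr
    have h₃ : 0 ≤ κ * ‖x p‖ ^ 2 := by positivity
    refine h₁.trans (abs_le.mpr ⟨by linarith, by linarith⟩)
  have ha' : ‖a‖ ≤ ‖a - κ • x p‖ + κ * R := by
    have h₁ := norm_le_norm_sub_add a (κ • x p)
    rw [norm_smul, Real.norm_of_nonneg hκ0.le] at h₁
    have h₂ : κ * ‖x p‖ ≤ κ * R := by gcongr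
    linarith
  linarith

end Global

end SelfShrinker

theorem mainTheorem7 {m : ℕ} (hm : 1 ≤ m)
    {M : Type*} [TopologicalSpace M] [T2Space M] [CompactSpace M] [ConnectedSpace M]
    [ChartedSpace (SelfShrinker.Euc m) M] [IsManifold (𝓡 m) ∞ M]
    (x : M → SelfShrinker.Euc (m + 1)) (hx : SelfShrinker.IsSelfShrinker x)
    (a : SelfShrinker.Euc (m + 1)) (ha : a ≠ 0) :
    ¬ Set.range x ⊆ {y | 0 ≤ inner ℝ a y} ∧ ¬ Set.range x ⊆ {y | inner ℝ a y ≤ 0} := by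
  constructor
  · intro h
    exact hx.not_forall_inner_nonneg hm ha fun p => h ⟨p, rfl⟩
  · intro h
    refine hx.not_forall_inner_nonneg hm (neg_ne_zero.mpr ha) fun p => ?_
    rw [inner_neg_left]
    exact neg_nonneg.mpr (h ⟨p, rfl⟩)
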